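/- There is an absolute constant $C>0$ such that the following holds. Let $d\ge 1$, let $F$ be a symmetric probability distribution on $\mathbb{R}^d$ (that is, if $X\sim F$ then $-X\sim F$) whose support is contained in $\mathbb{Z}^d$, and assume that $q:=F\{0\}\in(0,1)$. For $y\ge 0$ put \[ \delta(y)=\sum_{x\in\mathbb{Z}^d\setminus\{0\}}\min\bigl(1,\,y\,e\,F\{x\}\bigr), \] where $e$ is the base of the natural logarithm. Then, for every integer $n\ge 1$, \[ d(F^{*n},F^{*(n+1)})\le \frac{C\,(\delta^2(n)+1)}{q^{7/2}\,n}, \] where $F^{*n}$ is the $n$-fold convolution power of $F$, $\delta^2(n)=(\delta(n))^2$, and $d(G,H)=\sup_B|G(B)-H(B)|$ (supremum over all Borel sets $B\subset\mathbb{R}^d$) is the total variation distance. In particular, $C$ does not depend on $d$, $F$, $q$ or $n$. -/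

import Mathlib

open MeasureTheory

/-- The integer lattice `ℤ^d`, as a subset of `ℝ^d`. -/
def integerLattice (d : ℕ) : Set (Fin d → ℝ) :=
  {x | ∃ m : Fin d → ℤ, ∀ i, x i = (m i : ℝ)}

/-- A law `F` on `ℝ^d` is symmetric if `X ∼ F` implies `-X ∼ F`. -/
def IsSymmetricLaw {d : ℕ} (F : Measure (Fin d → ℝ)) : Prop :=
  F.map (fun x => -x) = F

/-- The `n`-fold convolution power `F^{*n}`, where `F^{*0}` is the unit mass at the origin. -/
noncomputable def convPower {d : ℕ} (F : Measure (Fin d → ℝ)) : ℕ → Measure (Fin d → ℝ)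
  | 0 => Measure.dirac 0
  | n + 1 => (convPower F n).conv F

/-- The total variation distance `sup_B |F(B) - G(B)|`, over all Borel sets `B` of `ℝ^d`.
For probability measures the supremum is over a nonempty family bounded by `1`. -/
noncomputable def tvDistance {d : ℕ} (F G : Measure (Fin d → ℝ)) : ℝ :=
  ⨆ B : {B : Set (Fin d → ℝ) // MeasurableSet B}, |F.real B.1 - G.real B.1|

/-- `δ(y) = ∑_{x ∈ ℤ^d, x ≠ 0} min(1, y e F{x})`. For `y ≥ 0` and a finite measure `F` the series
has nonnegative terms and converges, since the terms are at most `y e F{x}`. -/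
noncomputable def deltaSum {d : ℕ} (F : Measure (Fin d → ℝ)) (y : ℝ) : ℝ :=
  ∑' m : {m : Fin d → ℤ // m ≠ 0},
    min 1 (y * Real.exp 1 * F.real {fun i => (m.1 i : ℝ)})

/-! ### Binomial estimates in a normed algebra. -/

section NormedAlgebra

variable {A : Type*} [NormedRing A]

/-! Let `T = ∑ p g • S g` act on bounded functions on the lattice, `S g` being translation. The
distance is at most `‖T ^ n * (1 - T)‖`, and symmetry gives `1 - T = ∑ (p g / 2) • (1 - S g) * (1 -
S (-g))`. For `g ≠ 0` and `0 < m ≤ min (p g) (p 0 / 2)`, the masses `2m` at `0` and `m` at `±g`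
split off `m (1 + S g)(1 + S (-g))` from `T`. Expanding `T ^ n`, the `k`-th power of this smoothing
factor, normalized, brings `(1 - S g)(1 - S (-g))` down to norm `4 / (k + 1)`; averaging over `k ~
Bin(n, 4m)` gives `1 / ((n + 1) m)` (`HasSum.norm_pow_mul_one_sub_mul_one_sub_neg_le`). Summing over
`g` yields the bound `δ(n) / (q n)`, stronger than the one required. -/

theorem norm_pow_le_one_of_norm_le_one {S : A} (h1 : ‖(1 : A)‖ ≤ 1) (hS : ‖S‖ ≤ 1) (j : ℕ) :
    ‖S ^ j‖ ≤ 1 := by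
  induction j with
  | zero => simpa using h1
  | succ j ih =>
    rw [pow_succ]
    exact (norm_mul_le _ _).trans (mul_le_one₀ ih (norm_nonneg _) hS)

/-- The variance of `Bin(N, 1/2)`, rescaled by `4 * 2 ^ N`. -/
theorem sum_choose_mul_sq_sub (N : ℕ) :
    ∑ j ∈ Finset.range (N + 1), (N.choose j : ℝ) * ((N : ℝ) - 2 * j) ^ 2 =
      (N : ℝ) * 2 ^ N := by
  have h := congrArg (Polynomial.eval (1 / 2 : ℝ)) (bernsteinPolynomial.variance ℝ N)
  simp only [Polynomial.eval_finsetSum, bernsteinPolynomial, Polynomial.eval_mul,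
    Polynomial.eval_pow, Polynomial.eval_sub, Polynomial.eval_natCast, Polynomial.eval_X,
    Polynomial.eval_one, nsmul_eq_mul] at h
  have h2 : ∀ j ∈ Finset.range (N + 1), (N.choose j : ℝ) * ((N : ℝ) - 2 * j) ^ 2 =
      4 * 2 ^ N * (((N : ℝ) * (1 / 2) - j) ^ 2 *
        (N.choose j * (1 / 2) ^ j * (1 - 1 / 2) ^ (N - j))) := by
    intro j hj
    have hj' : j + (N - j) = N := by have := Finset.mem_range.1 hj; omega
    have : (1 / 2 : ℝ) ^ j * (1 - 1 / 2) ^ (N - j) = (1 / 2) ^ N := by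
      rw [show (1 - 1 / 2 : ℝ) = 1 / 2 by norm_num, ← pow_add, hj']
    have h3 : (2 : ℝ) ^ N * (1 / 2) ^ N = 1 := by rw [← mul_pow]; norm_num
    linear_combination (-4 * 2 ^ N * ((N : ℝ) * (1 / 2) - j) ^ 2 * (N.choose j : ℝ)) * this
      - 4 * ((N : ℝ) * (1 / 2) - j) ^ 2 * (N.choose j : ℝ) * h3
  rw [Finset.sum_congr rfl h2, ← Finset.mul_sum, h]
  ring

/-- Cauchy–Schwarz: mean absolute deviation is at most standard deviation. -/
theorem sum_choose_mul_abs_sub_le (N : ℕ) :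
    ∑ j ∈ Finset.range (N + 1), (N.choose j : ℝ) * |(N : ℝ) - 2 * j| ≤ 2 ^ N * √N := by
  have hcs := Finset.sum_mul_sq_le_sq_mul_sq (Finset.range (N + 1))
    (fun j => √(N.choose j : ℝ)) (fun j => √(N.choose j : ℝ) * |(N : ℝ) - 2 * j|)
  have hsq : ∀ j : ℕ, √(N.choose j : ℝ) ^ 2 = N.choose j := fun j => Real.sq_sqrt (by positivity)
  have e1 : ∀ j : ℕ, √(N.choose j : ℝ) * (√(N.choose j : ℝ) * |(N : ℝ) - 2 * j|) =
      N.choose j * |(N : ℝ) - 2 * j| := fun j => by rw [← mul_assoc, ← sq, hsq]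
  simp only [e1, mul_pow, hsq, sq_abs, sum_choose_mul_sq_sub] at hcs
  have h2 : ∑ j ∈ Finset.range (N + 1), (N.choose j : ℝ) = 2 ^ N := by
    exact_mod_cast Nat.sum_range_choose N
  rw [h2] at hcs
  refine abs_le_of_sq_le_sq' ?_ (by positivity) |>.2
  rw [mul_pow, Real.sq_sqrt (by positivity)]
  linarith

/-- Formally, this is `S · d/dS` applied to `(1 + S) ^ (k + 1)`. -/
theorem sum_natCast_mul_choose_mul_pow (S : A) (k : ℕ) :
    ∑ j ∈ Finset.range (k + 2), (j : A) * ((k + 1).choose j : A) * S ^ j =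
      ((k : A) + 1) * ((1 + S) ^ k * S) := by
  rw [Finset.sum_range_succ', add_comm (1 : A) S, (Commute.one_right S).add_pow,
    Finset.sum_mul, Finset.mul_sum]
  simp only [Nat.cast_zero, zero_mul, add_zero]
  refine Finset.sum_congr rfl fun j _ => ?_
  have h : ((j + 1 : ℕ) : A) * ((k + 1).choose (j + 1) : A) = (k + 1) * (k.choose j : A) := by
    have := Nat.add_one_mul_choose_eq k j
    rw [mul_comm (((k+1).choose (j+1)))] at this
    simpa using congrArg (Nat.cast : ℕ → A) this.symm
  rw [h, one_pow, mul_one, pow_succ, ← (Nat.cast_commute (k.choose j) (S ^ j)).eq]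
  simp only [mul_assoc]

/-- After multiplication by `k + 1`, the coefficient of `S ^ j` is `C(k+1, j) (k + 1 - 2j)`, so the
norm is controlled by the absolute deviation of a binomial law. -/
theorem norm_one_add_pow_mul_one_sub_le [NormedAlgebra ℝ A] {S : A} (h1 : ‖(1 : A)‖ ≤ 1)
    (hS : ‖S‖ ≤ 1) (k : ℕ) :
    ‖(1 + S) ^ k * (1 - S)‖ ≤ 2 ^ (k + 1) / √(k + 1) := by
  have hid : ((k : ℝ) + 1) • ((1 + S) ^ k * (1 - S)) =
      ∑ j ∈ Finset.range (k + 1 + 1),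
        (((k + 1).choose j : ℝ) * (((k + 1 : ℕ) : ℝ) - 2 * j)) • S ^ j := by
    have h2 : (1 + S) ^ (k + 1) = ∑ j ∈ Finset.range (k + 1 + 1), ((k + 1).choose j : A) * S ^ j := by
      rw [add_comm (1 : A) S, (Commute.one_right S).add_pow]
      exact Finset.sum_congr rfl fun j _ => by
        rw [one_pow, mul_one, (Nat.cast_commute _ (S ^ j)).eq]
    have h3 := sum_natCast_mul_choose_mul_pow S k
    have e : ∀ j : ℕ, (((k + 1).choose j : ℝ) * (((k + 1 : ℕ) : ℝ) - 2 * j)) • S ^ j =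
        ((k : A) + 1) * (((k + 1).choose j : A) * S ^ j) -
          2 * ((j : A) * ((k + 1).choose j : A) * S ^ j) := by
      intro j
      rw [Algebra.smul_def]
      simp only [map_mul, map_sub, map_natCast, map_ofNat]
      push_cast
      rw [mul_sub, sub_mul, (Nat.cast_commute ((k+1).choose j) ((k : A) + 1)).eq, mul_assoc,
        (Nat.cast_commute ((k+1).choose j) (2 * (j : A))).eq, mul_assoc, mul_assoc, mul_assoc]
    rw [Finset.sum_congr rfl fun j _ => e j, Finset.sum_sub_distrib, ← Finset.mul_sum,
      ← Finset.mul_sum, ← h2, h3, Algebra.smul_def]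
    simp only [map_add, map_natCast, map_one]
    have h4 : ∀ X : A, 2 * (((k : A) + 1) * X) = ((k : A) + 1) * (X + X) := fun X => by
      rw [two_mul, ← mul_add]
    rw [h4, ← mul_sub, pow_succ]
    congr 1
    noncomm_ring
  have hn : ((k : ℝ) + 1) * ‖(1 + S) ^ k * (1 - S)‖ ≤ 2 ^ (k + 1) * √((k + 1 : ℕ) : ℝ) := by
    rw [← Real.norm_of_nonneg (by positivity : (0 : ℝ) ≤ (k : ℝ) + 1), ← norm_smul, hid]
    refine (norm_sum_le _ _).trans (le_trans (Finset.sum_le_sum fun j _ => ?_)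
      (sum_choose_mul_abs_sub_le (k + 1)))
    rw [norm_smul, Real.norm_eq_abs, abs_mul, Nat.abs_cast]
    exact mul_le_of_le_one_right (by positivity) (norm_pow_le_one_of_norm_le_one h1 hS j)
  push_cast at hn
  rw [le_div_iff₀ (by positivity)]
  have hs : √((k : ℝ) + 1) * √((k : ℝ) + 1) = k + 1 := Real.mul_self_sqrt (by positivity)
  refine le_of_mul_le_mul_right ?_ (by positivity : 0 < √((k : ℝ) + 1))
  rw [mul_assoc, hs]
  linarith

/-- Since `C(n, k) / (k + 1) = C(n+1, k+1) / (n + 1)`, the sum is part of a binomial expansion of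
`1`. -/
theorem sum_choose_mul_div_succ_le {r : ℝ} (hr : 0 < r) (hr1 : r ≤ 1) (n : ℕ) :
    ∑ k ∈ Finset.range (n + 1), r ^ k * (1 - r) ^ (n - k) * (n.choose k) * (1 / ((k : ℝ) + 1)) ≤
      1 / ((n + 1) * r) := by
  have h := add_pow r (1 - r) (n + 1)
  rw [Finset.sum_range_succ'] at h
  simp only [add_sub_cancel, one_pow, Nat.add_sub_add_right] at h
  have hpos : 0 ≤ r ^ 0 * (1 - r) ^ (n + 1 - 0) * ((n + 1).choose 0 : ℝ) := by
    have : 0 ≤ 1 - r := by linarith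
    positivity
  rw [le_div_iff₀ (by positivity), Finset.sum_mul]
  refine le_trans (le_of_eq (Finset.sum_congr rfl fun k _ => ?_)) (by linarith :
    ∑ k ∈ Finset.range (n + 1), r ^ (k + 1) * (1 - r) ^ (n - k) * ((n + 1).choose (k + 1) : ℝ) ≤ 1)
  have h2 : ((n : ℝ) + 1) * n.choose k = (n + 1).choose (k + 1) * (k + 1) := by
    exact_mod_cast Nat.add_one_mul_choose_eq n k
  rw [mul_one_div, div_mul_eq_mul_div, div_eq_iff (by positivity)]
  linear_combination r ^ (k + 1) * (1 - r) ^ (n - k) * h2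

/-- If `T = R + r K` with `K = (1 + S) (1 + S') / 4`, then `T ^ n (1 - S) (1 - S')` has norm
of order `1 / (n r)`. -/
theorem norm_pow_mul_one_sub_mul_one_sub_le [NormedAlgebra ℝ A] {S S' R : A} {r : ℝ}
    (h1 : ‖(1 : A)‖ ≤ 1) (hS : ‖S‖ ≤ 1) (hS' : ‖S'‖ ≤ 1) (hr : 0 < r) (hr1 : r ≤ 1)
    (hR : ‖R‖ ≤ 1 - r) (hSS' : Commute S S') (hRS : Commute R S) (hRS' : Commute R S') (n : ℕ) :
    ‖(R + (r / 4) • ((1 + S) * (1 + S'))) ^ n * ((1 - S) * (1 - S'))‖ ≤ 4 / ((n + 1) * r) := by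
  have hcK : Commute ((r / 4) • ((1 + S) * (1 + S'))) R :=
    (((Commute.one_right R).add_right hRS).mul_right
      ((Commute.one_right R).add_right hRS')).symm.smul_left _
  have hc1 : Commute (1 + S') (1 - S) :=
    ((Commute.one_right _).sub_right ((Commute.one_left S).add_left hSS'.symm))
  have hc2 : Commute (1 + S) (1 + S') :=
    ((Commute.one_right _).add_right ((Commute.one_left S').add_left hSS'))
  have hc3 : Commute (1 - S) R := ((Commute.one_right R).sub_right hRS).symm
  have hc4 : Commute (1 - S') R := ((Commute.one_right R).sub_right hRS').symm
  have hRp : ∀ m, ‖R ^ m‖ ≤ (1 - r) ^ m := by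
    intro m
    induction m with
    | zero => simpa using h1
    | succ m ih =>
      rw [pow_succ, pow_succ]
      exact (norm_mul_le _ _).trans
        (mul_le_mul ih hR (norm_nonneg _) (pow_nonneg (by linarith) _))
  rw [add_comm R, hcK.add_pow, Finset.sum_mul]
  refine (norm_sum_le _ _).trans ?_
  calc _ ≤ ∑ k ∈ Finset.range (n + 1),
        4 * (r ^ k * (1 - r) ^ (n - k) * (n.choose k) * (1 / ((k : ℝ) + 1))) := by
        refine Finset.sum_le_sum fun k _ => ?_
        have hcast : ((n.choose k : ℕ) : A) = algebraMap ℝ A (n.choose k : ℝ) := by simp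
        have hcom : R ^ (n - k) * ((1 - S) * (1 - S')) = (1 - S) * (1 - S') * R ^ (n - k) :=
          ((hc3.mul_left hc4).pow_right _).eq.symm
        have key : ((r / 4) • ((1 + S) * (1 + S'))) ^ k * R ^ (n - k) * ((n.choose k : ℕ) : A) *
            ((1 - S) * (1 - S')) = ((r / 4) ^ k * (n.choose k : ℝ)) •
            (((1 + S) ^ k * (1 - S)) * ((1 + S') ^ k * (1 - S')) * R ^ (n - k)) := by
          rw [mul_assoc _ _ ((1 - S) * (1 - S')), (Nat.cast_commute _ ((1 - S) * (1 - S'))).eq,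
            hcast, ← Algebra.commutes, ← Algebra.smul_def, smul_pow, hc2.mul_pow,
            mul_smul_comm, mul_assoc _ (R ^ _), hcom, smul_mul_assoc, smul_smul,
            mul_comm (n.choose k : ℝ)]
          congr 1
          simp only [← mul_assoc]
          rw [mul_assoc ((1 + S) ^ k) ((1 + S') ^ k) (1 - S), (hc1.pow_left k).eq]
          simp only [mul_assoc]
        rw [key, norm_smul, Real.norm_of_nonneg (by positivity)]
        have b1 := norm_one_add_pow_mul_one_sub_le h1 hS k
        have b2 := norm_one_add_pow_mul_one_sub_le h1 hS' k
        have b3 := hRp (n - k)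
        have hs : √((k : ℝ) + 1) * √((k : ℝ) + 1) = k + 1 := Real.mul_self_sqrt (by positivity)
        calc _ ≤ ((r / 4) ^ k * (n.choose k : ℝ)) * (2 ^ (k + 1) / √(k + 1) *
              (2 ^ (k + 1) / √(k + 1)) * (1 - r) ^ (n - k)) := by
              refine mul_le_mul_of_nonneg_left ?_ (by positivity)
              refine (norm_mul_le _ _).trans (mul_le_mul ?_ b3 (norm_nonneg _) (by positivity))
              exact (norm_mul_le _ _).trans (mul_le_mul b1 b2 (norm_nonneg _) (by positivity))
          _ = _ := by
              rw [div_mul_div_comm, hs, div_pow, ← mul_pow]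
              rw [show (2 * 2 : ℝ) = 4 by norm_num, pow_succ]
              field_simp
    _ ≤ 4 * (1 / ((n + 1) * r)) := by
        rw [← Finset.mul_sum]
        exact mul_le_mul_of_nonneg_left (sum_choose_mul_div_succ_le hr hr1 n) (by norm_num)
    _ = _ := by ring

end NormedAlgebra

/-! ### Symmetric averages of contractions indexed by a group. -/

section WeightedSums

variable {A : Type*} [NormedRing A] [NormedAlgebra ℝ A] {G : Type*}

theorem summable_smul_of_norm_le_one [CompleteSpace A] {S : G → A} (hS : ∀ g, ‖S g‖ ≤ 1)
    {c : G → ℝ} (hc0 : ∀ g, 0 ≤ c g) (hc : Summable c) : Summable fun g => c g • S g := by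
  refine Summable.of_norm_bounded hc fun g => ?_
  rw [norm_smul, Real.norm_of_nonneg (hc0 g)]
  exact mul_le_of_le_one_right (hc0 g) (hS g)

theorem HasSum.norm_le_of_norm_le_one {S : G → A} (hS : ∀ g, ‖S g‖ ≤ 1) {c : G → ℝ}
    (hc0 : ∀ g, 0 ≤ c g) {a : ℝ} (hc : HasSum c a) {T : A} (hT : HasSum (fun g => c g • S g) T) :
    ‖T‖ ≤ a := by
  refine hT.norm_le_of_bounded hc fun g => ?_
  rw [norm_smul, Real.norm_of_nonneg (hc0 g)]
  exact mul_le_of_le_one_right (hc0 g) (hS g)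

variable [AddCommGroup G]

theorem HasSum.norm_pow_mul_one_sub_mul_one_sub_neg_le [CompleteSpace A] {S : G → A}
    (hS0 : S 0 = 1) (hSadd : ∀ g h, S (g + h) = S g * S h) (hS : ∀ g, ‖S g‖ ≤ 1) {p : G → ℝ}
    (hp0 : ∀ g, 0 ≤ p g) (hsym : ∀ g, p (-g) = p g) (hp : HasSum p 1) {T : A}
    (hT : HasSum (fun g => p g • S g) T) {g : G} (hg : g ≠ 0) (hgn : -g ≠ g)
    {m : ℝ} (hm : 0 < m) (hmg : m ≤ p g) (hm0 : 2 * m ≤ p 0) (n : ℕ) :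
    ‖T ^ n * ((1 - S g) * (1 - S (-g)))‖ ≤ 1 / ((n + 1) * m) := by
  classical
  have hcomm : ∀ a b, Commute (S a) (S b) := fun a b => by
    rw [Commute, SemiconjBy, ← hSadd, ← hSadd, add_comm]
  -- The piece split off from `p`, of total mass `4 * m`; `hgn` keeps its atoms at `g` and `-g`
  -- distinct.
  set e : G → ℝ := fun h => (if h = 0 then 2 * m else 0) + (if h = g then m else 0) +
    (if h = -g then m else 0) with he
  have hesum : HasSum e (4 * m) := by
    have := ((hasSum_ite_eq (0 : G) (2 * m)).add (hasSum_ite_eq g m)).add (hasSum_ite_eq (-g) m)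
    convert this using 1
    ring
  have heS : HasSum (fun h => e h • S h) ((2 * m) • S 0 + m • S g + m • S (-g)) := by
    have := ((hasSum_ite_eq (0 : G) ((2 * m) • S 0)).add (hasSum_ite_eq g (m • S g))).add
      (hasSum_ite_eq (-g) (m • S (-g)))
    convert this using 2 with h
    simp only [he, add_smul, ite_smul, zero_smul]
    congr 1
    · congr 1
      · split_ifs with h0 <;> simp [h0]
      · split_ifs with h0 <;> simp [h0]
    · split_ifs with h0 <;> simp [h0]
  have hle : ∀ h, e h ≤ p h := by
    intro h
    simp only [he]
    by_cases h0 : h = 0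
    · subst h0
      simpa [hg.symm, (neg_ne_zero.2 hg).symm] using hm0
    · by_cases h1 : h = g
      · subst h1
        simpa [h0, hgn.symm] using hmg
      · by_cases h2 : h = -g
        · subst h2
          simpa [hg, hgn, hsym] using hmg
        · simpa [h0, h1, h2] using hp0 h
  have hr1 : 4 * m ≤ 1 := hasSum_le hle hesum hp
  have hR : HasSum (fun h => (p h - e h) • S h)
      (T - ((2 * m) • S 0 + m • S g + m • S (-g))) := by
    simpa only [sub_smul] using hT.sub heS
  set R := T - ((2 * m) • S 0 + m • S g + m • S (-g)) with hRdef
  have hRn : ‖R‖ ≤ 1 - 4 * m :=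
    HasSum.norm_le_of_norm_le_one hS (fun h => sub_nonneg.2 (hle h)) (hp.sub hesum) hR
  have hRc : ∀ a, Commute R (S a) := fun a =>
    (hR.mul_right (S a)).unique <| by
      convert hR.mul_left (S a) using 2 with h
      rw [smul_mul_assoc, mul_smul_comm, (hcomm h a).eq]
  have hmul : S g * S (-g) = 1 := by rw [← hSadd, add_neg_cancel, hS0]
  have hTR : T = R + (4 * m / 4) • ((1 + S g) * (1 + S (-g))) := by
    rw [hRdef, hS0, mul_add, add_mul, add_mul, hmul, mul_div_cancel_left₀ m (by norm_num)]
    simp only [one_mul, mul_one, smul_add, two_mul, add_smul]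
    abel
  have := norm_pow_mul_one_sub_mul_one_sub_le (hS0 ▸ hS 0) (hS g) (hS (-g))
    (by positivity : 0 < 4 * m) hr1 hRn (hcomm g (-g)) (hRc g) (hRc (-g)) n
  rw [← hTR] at this
  refine this.trans (le_of_eq ?_)
  field_simp

theorem HasSum.norm_pow_mul_one_sub_le [CompleteSpace A] {S : G → A}
    (hS0 : S 0 = 1) (hSadd : ∀ g h, S (g + h) = S g * S h) (hS : ∀ g, ‖S g‖ ≤ 1) {p : G → ℝ}
    (hp0 : ∀ g, 0 ≤ p g) (hsym : ∀ g, p (-g) = p g) (hp : HasSum p 1) {T : A}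
    (hT : HasSum (fun g => p g • S g) T) (htors : ∀ g : G, g ≠ 0 → -g ≠ g) (hq : 0 < p 0)
    {n : ℕ} (hn : 1 ≤ n) :
    ‖T ^ n * (1 - T)‖ ≤
      (∑' g : {g : G // g ≠ 0}, min 1 (n * Real.exp 1 * p g.1)) / (p 0 * n) := by
  have hn0 : (0 : ℝ) < n := by exact_mod_cast hn
  have hp1 : ∀ g, p g ≤ 1 := fun g => le_hasSum hp g fun h _ => hp0 h
  have hmul : ∀ g, S g * S (-g) = 1 := fun g => by rw [← hSadd, add_neg_cancel, hS0]
  have hT' : HasSum (fun g => p g • S (-g)) T := by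
    have := (Equiv.neg G).hasSum_iff.2 hT
    convert this using 2 with g
    simp [hsym]
  have h1 : HasSum (fun g => p g • (1 : A)) 1 := by simpa using hp.smul_const (1 : A)
  -- Averaging the series over `g` and `-g` turns `1 - S g` into half of `2 - S g - S (-g) = (1 - S
  -- g) * (1 - S (-g))`.
  have hdec : HasSum (fun g => (p g / 2) • (T ^ n * ((1 - S g) * (1 - S (-g)))))
      (T ^ n * (1 - T)) := by
    have := ((((h1.add h1).sub hT).sub hT').const_smul (1 / 2 : ℝ)).mul_left (T ^ n)
    have hlim : (1 / 2 : ℝ) • ((1 : A) + 1 - T - T) = 1 - T := by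
      rw [show (1 : A) + 1 - T - T = (2 : ℝ) • (1 - T) by rw [two_smul]; abel, smul_smul]
      norm_num
    rw [hlim] at this
    refine Eq.subst (motive := fun f => HasSum f (T ^ n * (1 - T)))
      (funext fun g => Eq.symm ?_) this
    rw [← mul_smul_comm]
    congr 1
    rw [mul_sub, sub_mul, sub_mul, hmul, ← smul_add, ← smul_sub, ← smul_sub, smul_smul,
      one_div, mul_comm (2⁻¹ : ℝ), div_eq_mul_inv]
    congr 1
    noncomm_ring
  have hsum : Summable fun g : {g : G // g ≠ 0} => min 1 (n * Real.exp 1 * p g.1) := by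
    refine Summable.of_nonneg_of_le (fun g => le_min zero_le_one ?_) (fun g => min_le_right _ _)
      ((hp.summable.subtype _).mul_left _)
    have := hp0 g.1
    positivity
  have hbd := (hasSum_subtype_iff_indicator
    (f := fun g => min 1 (n * Real.exp 1 * p g)) (s := {g : G | g ≠ 0})).1 hsum.hasSum
  refine hdec.norm_le_of_bounded (hbd.div_const (p 0 * n)) fun g => ?_
  rw [norm_smul, Real.norm_of_nonneg (by have := hp0 g; positivity)]
  by_cases hg : g = 0
  · simp [hg, hS0]
  rw [Set.indicator_of_mem (by exact hg)]
  rcases (hp0 g).eq_or_lt with hz | hpos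
  · simp [← hz]
  have hone : ‖(1 : A)‖ ≤ 1 := hS0 ▸ hS 0
  have hTn : ‖T ^ n‖ ≤ 1 := norm_pow_le_one_of_norm_le_one hone
    (HasSum.norm_le_of_norm_le_one hS hp0 hp hT) n
  have hS2 : ∀ h, ‖1 - S h‖ ≤ 2 := fun h =>
    (norm_sub_le _ _).trans (by linarith [hS h])
  rw [le_div_iff₀ (by positivity), mul_right_comm]
  refine le_min ?_ ?_
  -- The bound `1` comes from smoothing with `m = min (p g) (p 0 / 2)`; the other factor of `p g * p
  -- 0 / 2` is at most `1`.
  · have hb : ∀ m, 0 < m → m ≤ p g → 2 * m ≤ p 0 →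
        ‖T ^ n * ((1 - S g) * (1 - S (-g)))‖ * (n * m) ≤ 1 := fun m hm h2 h3 => by
      have := HasSum.norm_pow_mul_one_sub_mul_one_sub_neg_le hS0 hSadd hS hp0 hsym hp hT hg
        (htors g hg) hm h2 h3 n
      rw [le_div_iff₀ (by positivity)] at this
      refine le_trans (mul_le_mul_of_nonneg_left ?_ (norm_nonneg _)) this
      exact mul_le_mul_of_nonneg_right (by linarith) hm.le
    have hN := norm_nonneg (T ^ n * ((1 - S g) * (1 - S (-g))))
    set N := ‖T ^ n * ((1 - S g) * (1 - S (-g)))‖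
    rcases le_total (p g) (p 0 / 2) with h | h
    · have := hb (p g) hpos le_rfl (by linarith)
      calc _ = N * (n * p g) * (p 0 / 2) := by ring
        _ ≤ 1 * 1 := mul_le_mul this (by linarith [hp1 0]) (by linarith) zero_le_one
        _ = 1 := one_mul 1
    · have := hb (p 0 / 2) (by linarith) h (by linarith)
      calc _ = N * (n * (p 0 / 2)) * p g := by ring
        _ ≤ 1 * 1 := mul_le_mul this (hp1 g) hpos.le zero_le_one
        _ = 1 := one_mul 1
  -- For small `p g` the trivial bound `4` suffices, as `4 / 2 ≤ e`.
  · have hN : ‖T ^ n * ((1 - S g) * (1 - S (-g)))‖ ≤ 1 * (2 * 2) :=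
      (norm_mul_le _ _).trans (mul_le_mul hTn ((norm_mul_le _ _).trans
        (mul_le_mul (hS2 g) (hS2 (-g)) (norm_nonneg _) zero_le_two)) (norm_nonneg _) zero_le_one)
    have hexp : 2 ≤ Real.exp 1 := by linarith [Real.add_one_le_exp 1]
    calc _ ≤ p g / 2 * (1 * n) * (1 * (2 * 2)) := by
          refine mul_le_mul ?_ hN (norm_nonneg _) (by positivity)
          exact mul_le_mul_of_nonneg_left
            (mul_le_mul_of_nonneg_right (hp1 0) hn0.le) (by positivity)
      _ = n * 2 * p g := by ring
      _ ≤ _ := by gcongr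

end WeightedSums
-- Translation operators.
section Shift

open BoundedContinuousFunction

variable {G : Type*} [AddCommGroup G] [TopologicalSpace G] [DiscreteTopology G]

/-- Translation by `g`, acting on the bounded functions on a discrete group. -/
noncomputable def shiftOperator (g : G) : (G →ᵇ ℝ) →L[ℝ] (G →ᵇ ℝ) :=
  LinearMap.mkContinuous
    { toFun := fun f => f.compContinuous ⟨fun h => h + g, continuous_of_discreteTopology⟩
      map_add' := fun _ _ => rfl
      map_smul' := fun _ _ => rfl }
    1 fun f => by
      rw [one_mul]
      exact (norm_le (norm_nonneg f)).2 fun h => f.norm_coe_le_norm (h + g)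

@[simp]
theorem shiftOperator_apply (g : G) (f : G →ᵇ ℝ) (h : G) : shiftOperator g f h = f (h + g) := rfl

theorem norm_shiftOperator_le (g : G) : ‖shiftOperator g‖ ≤ 1 :=
  LinearMap.mkContinuous_norm_le _ zero_le_one _

theorem shiftOperator_zero : shiftOperator (0 : G) = 1 := by
  ext f h
  simp

theorem shiftOperator_add (g h : G) :
    shiftOperator (g + h) = shiftOperator g * shiftOperator h := by
  ext f k
  simp [add_assoc]

end Shift

/-! ### From lattice laws to operators. -/

section LatticeLaw

open BoundedContinuousFunction

variable {d : ℕ}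

/-- The embedding of `ℤ^d` into `ℝ^d`. -/
def latticeEmbedding (m : Fin d → ℤ) : Fin d → ℝ := fun i => (m i : ℝ)

theorem latticeEmbedding_injective : Function.Injective (latticeEmbedding (d := d)) :=
  fun _ _ h => funext fun i => Int.cast_injective (congrFun h i)

theorem latticeEmbedding_add (m k : Fin d → ℤ) :
    latticeEmbedding (m + k) = latticeEmbedding m + latticeEmbedding k := by
  ext i
  simp [latticeEmbedding]

theorem latticeEmbedding_neg (m : Fin d → ℤ) :
    latticeEmbedding (-m) = -latticeEmbedding m := by
  ext i
  simp [latticeEmbedding]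

theorem latticeEmbedding_zero : latticeEmbedding (0 : Fin d → ℤ) = 0 := by
  ext i
  simp [latticeEmbedding]

theorem range_latticeEmbedding : Set.range (latticeEmbedding (d := d)) = integerLattice d := by
  ext x
  exact ⟨fun ⟨m, hm⟩ => ⟨m, fun i => by rw [← hm]; rfl⟩, fun ⟨m, hm⟩ => ⟨m, (funext hm).symm⟩⟩

theorem integral_eq_tsum_of_support_subset_integerLattice {F : Measure (Fin d → ℝ)}
    (hF : F.support ⊆ integerLattice d) {f : (Fin d → ℝ) → ℝ} (hf : Integrable f F) :
    ∫ x, f x ∂F = ∑' m, F.real {latticeEmbedding m} * f (latticeEmbedding m) := by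
  have hae : ∀ᵐ x ∂F, x ∈ Set.range (latticeEmbedding (d := d)) := by
    rw [range_latticeEmbedding]
    exact Filter.mem_of_superset Measure.support_mem_ae hF
  have h := setIntegral_countable f (Set.countable_range (latticeEmbedding (d := d)))
    hf.integrableOn
  rw [Measure.restrict_eq_self_of_ae_mem hae] at h
  rw [h, ← (Equiv.ofInjective _ latticeEmbedding_injective).tsum_eq]
  rfl

theorem hasSum_real_singleton_latticeEmbedding {F : Measure (Fin d → ℝ)} [IsProbabilityMeasure F]
    (hF : F.support ⊆ integerLattice d) :
    HasSum (fun m : Fin d → ℤ => F.real {latticeEmbedding m}) 1 := by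
  have h := integral_eq_tsum_of_support_subset_integerLattice hF (integrable_const (1 : ℝ))
  -- A non-summable `tsum` would be `0`, but `h` equates it with the total mass.
  have hs : Summable fun m : Fin d → ℤ => F.real {latticeEmbedding m} := by
    by_contra hs
    simp [tsum_eq_zero_of_not_summable hs] at h
  simp only [integral_const, probReal_univ, smul_eq_mul, mul_one] at h
  exact h ▸ hs.hasSum

instance isProbabilityMeasure_convPower (F : Measure (Fin d → ℝ)) [IsProbabilityMeasure F]
    (n : ℕ) : IsProbabilityMeasure (convPower F n) := by
  induction n with
  | zero => exact Measure.dirac.isProbabilityMeasure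
  | succ n ih =>
    rw [convPower]
    infer_instance

/-- Integrating out the last summand replaces the test function by its image under `T`, hence the
induction over all bounded `f` and their lattice restrictions `u`. -/
theorem integral_convPower {F : Measure (Fin d → ℝ)} [IsProbabilityMeasure F]
    (hF : F.support ⊆ integerLattice d)
    {T : ((Fin d → ℤ) →ᵇ ℝ) →L[ℝ] ((Fin d → ℤ) →ᵇ ℝ)}
    (hT : HasSum (fun m => F.real {latticeEmbedding m} • shiftOperator m) T) (n : ℕ)
    {f : (Fin d → ℝ) → ℝ} (hf : Measurable f) {b : ℝ} (hb : ∀ x, ‖f x‖ ≤ b)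
    {u : (Fin d → ℤ) →ᵇ ℝ} (hu : ∀ m, u m = f (latticeEmbedding m)) :
    ∫ x, f x ∂(convPower F n) = (T ^ n) u 0 := by
  induction n generalizing f u with
  | zero =>
    rw [convPower, integral_dirac, pow_zero, one_apply_eq_self, hu,
      latticeEmbedding_zero]
  | succ n ih =>
    have hint : ∀ (μ : Measure (Fin d → ℝ)) [IsProbabilityMeasure μ] {g : (Fin d → ℝ) → ℝ},
        Measurable g → (∀ x, ‖g x‖ ≤ b) → Integrable g μ := fun μ _ g hg hgb =>
      Integrable.of_bound hg.aestronglyMeasurable b (Filter.Eventually.of_forall hgb)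
    rw [convPower, integral_conv (hint _ hf hb), pow_succ, mul_apply_eq_comp]
    refine ih ?_ ?_ ?_
    · exact (StronglyMeasurable.integral_prod_right' (f := fun p : (Fin d → ℝ) × (Fin d → ℝ) =>
        f (p.1 + p.2)) (hf.comp (measurable_fst.add measurable_snd)).stronglyMeasurable).measurable
    · intro x
      exact (norm_integral_le_of_norm_le_const (Filter.Eventually.of_forall
        fun y => hb (x + y))).trans (by simp)
    · intro m
      rw [integral_eq_tsum_of_support_subset_integerLattice hF (f := fun y => f (_ + y))
        (hint F (hf.comp (measurable_const_add _)) fun y => hb _)]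
      have h1 := hT.mapL ((evalCLM ℝ m).comp (ContinuousLinearMap.apply ℝ _ u))
      have h2 := h1.tsum_eq
      simp only [ContinuousLinearMap.comp_apply, ContinuousLinearMap.apply_apply,
        map_smul, evalCLM_apply, shiftOperator_apply, hu,
        latticeEmbedding_add, smul_eq_mul] at h2
      exact h2.symm

theorem tvDistance_convPower_succ_le {F : Measure (Fin d → ℝ)} [IsProbabilityMeasure F]
    (hF : F.support ⊆ integerLattice d)
    {T : ((Fin d → ℤ) →ᵇ ℝ) →L[ℝ] ((Fin d → ℤ) →ᵇ ℝ)}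
    (hT : HasSum (fun m => F.real {latticeEmbedding m} • shiftOperator m) T) (n : ℕ) :
    tvDistance (convPower F n) (convPower F (n + 1)) ≤ ‖T ^ n * (1 - T)‖ := by
  refine Real.iSup_le (fun ⟨B, hB⟩ => ?_) (ContinuousLinearMap.opNorm_nonneg _)
  have hf : Measurable (B.indicator (1 : (Fin d → ℝ) → ℝ)) := measurable_one.indicator hB
  have hb : ∀ x, ‖B.indicator (1 : (Fin d → ℝ) → ℝ) x‖ ≤ 1 := fun x =>
    (norm_indicator_le_norm_self _ _).trans (by simp)
  let u : (Fin d → ℤ) →ᵇ ℝ := BoundedContinuousFunction.ofNormedAddCommGroup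
    (fun m => B.indicator 1 (latticeEmbedding m)) continuous_of_discreteTopology 1 fun m => hb _
  have hu : ‖u‖ ≤ 1 := norm_ofNormedAddCommGroup_le _ zero_le_one _
  have h := fun k => integral_convPower hF hT k hf hb (u := u) fun m => rfl
  simp only [integral_indicator_one hB] at h
  have hsub : (T ^ n) u 0 - (T ^ (n + 1)) u 0 = (T ^ n * (1 - T)) u 0 := by
    rw [pow_succ]
    exact congrArg (fun V : ((Fin d → ℤ) →ᵇ ℝ) →L[ℝ] ((Fin d → ℤ) →ᵇ ℝ) => V u 0)
      (mul_one_sub (T ^ n) T).symm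
  rw [h, h, hsub, ← Real.norm_eq_abs]
  exact (norm_coe_le_norm _ 0).trans ((ContinuousLinearMap.le_opNorm _ u).trans
    (mul_le_of_le_one_right (norm_nonneg _) hu))

theorem tvDistance_convPower_succ_le_deltaSum_div {F : Measure (Fin d → ℝ)}
    [IsProbabilityMeasure F] (hsym : IsSymmetricLaw F) (hF : F.support ⊆ integerLattice d)
    (hq : 0 < F.real {0}) {n : ℕ} (hn : 1 ≤ n) :
    tvDistance (convPower F n) (convPower F (n + 1)) ≤ deltaSum F n / (F.real {0} * n) := by
  have hp := hasSum_real_singleton_latticeEmbedding hF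
  have hneg : ∀ m : Fin d → ℤ, F.real {latticeEmbedding (-m)} = F.real {latticeEmbedding m} := by
    intro m
    have h : F.real {latticeEmbedding m} =
        (F.map fun x => -x).real {latticeEmbedding m} := by rw [hsym]
    rw [h, map_measureReal_apply measurable_neg (measurableSet_singleton _), latticeEmbedding_neg]
    congr 1
    ext x
    simp
  have hT := (summable_smul_of_norm_le_one (S := shiftOperator (G := Fin d → ℤ))
    norm_shiftOperator_le (fun _ => measureReal_nonneg) hp.summable).hasSum
  have h := HasSum.norm_pow_mul_one_sub_le shiftOperator_zero shiftOperator_add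
    norm_shiftOperator_le (fun _ => measureReal_nonneg) hneg hp hT
    (fun g hg hgn => hg (self_eq_neg.1 hgn.symm)) (by rwa [latticeEmbedding_zero]) hn
  rw [latticeEmbedding_zero] at h
  exact (tvDistance_convPower_succ_le hF hT n).trans h

end LatticeLaw

/-! ### The bound in its stated form. -/

theorem theorem4 :
    ∃ C : ℝ, 0 < C ∧
      ∀ (d : ℕ) (F : Measure (Fin d → ℝ)) [IsProbabilityMeasure F] (q : ℝ),
        IsSymmetricLaw F →
        F.support ⊆ integerLattice d →
        q = F.real {0} →
        0 < q → q < 1 →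
        ∀ n : ℕ, 1 ≤ n →
          tvDistance (convPower F n) (convPower F (n + 1)) ≤
            C * (deltaSum F (n : ℝ) ^ 2 + 1) / (q ^ (7 / 2 : ℝ) * (n : ℝ)) := by
  -- `C = 1` works because `δ ≤ δ² + 1` and `q ^ (7/2) ≤ q`.
  refine ⟨1, one_pos, fun d F _ q hsym hF hq hq0 hq1 n hn => ?_⟩
  have hn0 : (0 : ℝ) < n := by exact_mod_cast hn
  have hpow : q ^ (7 / 2 : ℝ) ≤ q := by
    simpa using Real.rpow_le_rpow_of_exponent_ge hq0 hq1.le (by norm_num : (1 : ℝ) ≤ 7 / 2)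
  refine (tvDistance_convPower_succ_le_deltaSum_div hsym hF (hq ▸ hq0) hn).trans ?_
  rw [← hq, one_mul]
  exact div_le_div₀ (by positivity) (by nlinarith [sq_nonneg (deltaSum F n - 1 / 2)])
    (by positivity) (by gcongr)
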